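/- Let $N\ge 2$ and $d$ be integers, and let $\varrho$ be a state (density matrix) of $N$ parties, each with local Hilbert space $\mathbb{C}^d$, where $d$ is arbitrary. Write $F_{ij}$ for the flip operator that exchanges parties $i$ and $j$, and $\Pi^{\pm}_{ij}=\tfrac12(\mathbb{1}\pm F_{ij})$. The state $\varrho$ is called permutationally symmetric (bosonic) if $\Pi^+_{ij}\varrho\,\Pi^+_{ij}=\varrho$ for all $i\neq j$, and permutationally antisymmetric (fermionic) if $\Pi^-_{ij}\varrho\,\Pi^-_{ij}=\varrho$ for all $i\ne j$. It is called fully separable if $\varrho=\sum_k p_k\,\sigma_k^{(1)}\otimes\dots\otimes\sigma_k^{(N)}$ is a finite convex combination of product states. A network on $N$ nodes consists of finitely many sources $s$, each connected to a set $C_s\subseteq\{1,\dots,N\}$ of nodes; its sources are at most $k$-partite if $|C_s|\le k$ for all $s$. The state $\varrho$ can be generated in the network (with local channels and shared randomness) if there are source states $\varrho_s$, where $\varrho_s$ is a density matrix on $\bigotimes_{i\in C_s}\mathcal{H}_{s,i}$ with Hilbert spaces $\mathcal{H}_{s,i}$ of arbitrary finite dimension, a finite probability distribution $(p_\lambda)$,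 and for each $\lambda$ and each node $i$ a channel (completely positive trace-preserving linear map) $\mathcal{E}_i^{(\lambda)}$ from operators on $\bigotimes_{s:\,i\in C_s}\mathcal{H}_{s,i}$ to operators on $\mathbb{C}^d$, such that, after grouping the systems emitted by the sources according to the node that receives them, $$\varrho=\sum_\lambda p_\lambda\,\bigl(\mathcal{E}_1^{(\lambda)}\otimes\dots\otimes\mathcal{E}_N^{(\lambda)}\bigr)\Bigl[\bigotimes_s\varrho_s\Bigr].$$ Then: (a) If $\varrho$ is permutationally symmetric, then $\varrho$ can be generated in some network on its $N$ parties with at most $(N-1)$-partite sources if and only if $\varrho$ is fully separable. (b) If $\varrho$ is permutationally antisymmetric, then $\varrho$ cannot be generated in any network on its $N$ parties with at most $(N-1)$-partite sources. -/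

import Mathlib

open scoped ComplexOrder

namespace QuantumNetwork

/-- A density matrix (quantum state) on the finite-dimensional space `ℂ^α`. -/
def IsDensity {α : Type} [Fintype α] (ρ : Matrix α α ℂ) : Prop :=
  ρ.PosSemidef ∧ ρ.trace = 1

/-- The tensor product `⨂ i, A i` of a finite family of square matrices, acting on
`⨂ i, ℂ^(α i)`, whose computational basis is indexed by `∀ i, α i`. -/
def piTensor {ι : Type} [Fintype ι] {α : ι → Type} (A : ∀ i, Matrix (α i) (α i) ℂ) :
    Matrix (∀ i, α i) (∀ i, α i) ℂ :=
  Matrix.of fun x y => ∏ i, A i (x i) (y i)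

/-- The ampliation `id ⊗ E` of a map `E` by a `k`-dimensional ancilla. -/
def ampliation {α β : Type} (k : ℕ) (E : Matrix α α ℂ →ₗ[ℂ] Matrix β β ℂ)
    (X : Matrix (Fin k × α) (Fin k × α) ℂ) : Matrix (Fin k × β) (Fin k × β) ℂ :=
  Matrix.of fun p q => E (Matrix.of fun a b => X (p.1, a) (q.1, b)) p.2 q.2

/-- A quantum channel: a completely positive, trace-preserving linear map. -/
def IsChannel {α β : Type} [Fintype α] [Fintype β]
    (E : Matrix α α ℂ →ₗ[ℂ] Matrix β β ℂ) : Prop :=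
  (∀ (k : ℕ) (X : Matrix (Fin k × α) (Fin k × α) ℂ),
      X.PosSemidef → (ampliation k E X).PosSemidef) ∧
    ∀ X : Matrix α α ℂ, (E X).trace = X.trace

/-- The tensor product `⨂ i, E i` of linear maps, applied to `X`: the linear extension of
`⨂ i, |x i⟩⟨y i| ↦ ⨂ i, E i (|x i⟩⟨y i|)`. -/
def tensorMap {ι : Type} [Fintype ι] [DecidableEq ι] {α β : ι → Type}
    [∀ i, Fintype (α i)] [∀ i, DecidableEq (α i)]
    (E : ∀ i, Matrix (α i) (α i) ℂ →ₗ[ℂ] Matrix (β i) (β i) ℂ)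
    (X : Matrix (∀ i, α i) (∀ i, α i) ℂ) : Matrix (∀ i, β i) (∀ i, β i) ℂ :=
  ∑ x : ∀ i, α i, ∑ y : ∀ i, α i,
    X x y • piTensor fun i => E i (Matrix.single (x i) (y i) 1)

/-- A network topology on `N` nodes: finitely many sources, the source `s` being connected to
the set of nodes `conn s`. -/
structure Network (N : ℕ) where
  numSources : ℕ
  conn : Fin numSources → Finset (Fin N)

namespace Network

variable {N : ℕ} (G : Network N)

/-- Every source of the network sends systems to at most `k` nodes. -/
def AtMostPartite (k : ℕ) : Prop :=
  ∀ s, (G.conn s).card ≤ k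

/-- Basis labels of the joint system emitted by the source `s`, which sends a system of
dimension `dim s i` to each node `i` in `conn s`. -/
abbrev SourceSys (dim : Fin G.numSources → Fin N → ℕ) (s : Fin G.numSources) : Type :=
  ∀ i : {i : Fin N // i ∈ G.conn s}, Fin (dim s i)

/-- Basis labels of the joint system received by the node `i` from all its sources. -/
abbrev NodeSys (dim : Fin G.numSources → Fin N → ℕ) (i : Fin N) : Type :=
  ∀ s : {s : Fin G.numSources // i ∈ G.conn s}, Fin (dim s i)

/-- The reordering of the elementary systems from grouping by node to grouping by source. -/
def regroup (dim : Fin G.numSources → Fin N → ℕ) (x : ∀ i, G.NodeSys dim i) :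
    ∀ s, G.SourceSys dim s :=
  fun s i => x i.1 ⟨s, i.2⟩

/-- The global state `⨂ s, src s` of all sources, with its systems grouped by node. -/
def globalState (dim : Fin G.numSources → Fin N → ℕ)
    (src : ∀ s, Matrix (G.SourceSys dim s) (G.SourceSys dim s) ℂ) :
    Matrix (∀ i, G.NodeSys dim i) (∀ i, G.NodeSys dim i) ℂ :=
  (piTensor src).submatrix (G.regroup dim) (G.regroup dim)

/-- `ρ` can be generated in the network `G` with local channels and shared randomness:
`ρ = ∑ l, p l • (⨂ i, E l i) (⨂ s, src s)` for source states `src s` of arbitrary dimensions,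
a probability distribution `p` and local channels `E l i` depending on the shared random
variable `l`. -/
def Generates {d : ℕ} (ρ : Matrix (Fin N → Fin d) (Fin N → Fin d) ℂ) : Prop :=
  ∃ (dim : Fin G.numSources → Fin N → ℕ)
    (src : ∀ s, Matrix (G.SourceSys dim s) (G.SourceSys dim s) ℂ)
    (L : ℕ) (p : Fin L → ℝ)
    (E : Fin L → ∀ i, Matrix (G.NodeSys dim i) (G.NodeSys dim i) ℂ →ₗ[ℂ]
      Matrix (Fin d) (Fin d) ℂ),
    (∀ s, IsDensity (src s)) ∧ (∀ l, 0 ≤ p l) ∧ ∑ l, p l = 1 ∧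
    (∀ l i, IsChannel (E l i)) ∧
    ρ = ∑ l, (p l : ℂ) • tensorMap (E l) (G.globalState dim src)

end Network

variable {N d : ℕ}

/-- `ρ` can be generated in some network on its `N` parties, all of whose sources are at most
`k`-partite, with local channels and shared randomness. -/
def GeneratedWithSources (k : ℕ) (ρ : Matrix (Fin N → Fin d) (Fin N → Fin d) ℂ) : Prop :=
  ∃ G : Network N, G.AtMostPartite k ∧ G.Generates ρ

/-- Full separability: `ρ` is a convex combination of product states. -/
def FullySeparable (ρ : Matrix (Fin N → Fin d) (Fin N → Fin d) ℂ) : Prop :=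
  ∃ (K : ℕ) (p : Fin K → ℝ) (σ : Fin K → Fin N → Matrix (Fin d) (Fin d) ℂ),
    (∀ k, 0 ≤ p k) ∧ ∑ k, p k = 1 ∧ (∀ k i, IsDensity (σ k i)) ∧
    ρ = ∑ k, (p k : ℂ) • piTensor (σ k)

/-- The flip operator exchanging the parties `i` and `j`. -/
def flipOp (i j : Fin N) : Matrix (Fin N → Fin d) (Fin N → Fin d) ℂ :=
  Matrix.of fun x y => if x = y ∘ Equiv.swap i j then 1 else 0

/-- The projector `(1 + F_ij) / 2`. -/
noncomputable def symProj (i j : Fin N) : Matrix (Fin N → Fin d) (Fin N → Fin d) ℂ :=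
  (1 / 2 : ℂ) • (1 + flipOp i j)

/-- The projector `(1 - F_ij) / 2`. -/
noncomputable def antisymProj (i j : Fin N) : Matrix (Fin N → Fin d) (Fin N → Fin d) ℂ :=
  (1 / 2 : ℂ) • (1 - flipOp i j)

/-- Permutationally symmetric (bosonic). -/
def IsPermSymmetric (ρ : Matrix (Fin N → Fin d) (Fin N → Fin d) ℂ) : Prop :=
  ∀ i j : Fin N, i ≠ j → symProj i j * ρ * symProj i j = ρ

/-- Permutationally antisymmetric (fermionic). -/
def IsPermAntisymmetric (ρ : Matrix (Fin N → Fin d) (Fin N → Fin d) ℂ) : Prop :=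
  ∀ i j : Fin N, i ≠ j → antisymProj i j * ρ * antisymProj i j = ρ

end QuantumNetwork

/-!
The proof compares the network with its *cut inflation*.

Fix a value of the shared randomness, and let `σ` be the state that the network then generates.
Every source `s` misses some node `m s`. Take two copies of every source and of every node, arrange
the `2 N` node copies in a ring `0, …, N - 1, 0', …, (N - 1)'`, and let each of the two copies of
`s` serve the nodes of one of the two arcs into which the copies of `m s` cut this ring
(`Network.wiring`). This gives a state `γ` (`Network.inflation`) such that

* neighbours in the ring use the same copies of their common sources, so they have the same joint
  marginal as in `σ` (`Network.trace_inflation_mul_pairObs`);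
* the two copies of a node share no source, so they are uncorrelated
  (`Network.trace_inflation_mul_pairObs_copies`).

Both facts are instances of `Network.trace_inflation_mul_of_factor`. If `σ` has expectation value
`ε = ±1` for all flips, then `γ F = ε γ` for the flips `F` of neighbours, because `γ` is positive.
Since `F_bc F_ab F_bc = F_ac`, this propagates along the ring from the node `0` to its copy `0'`.
But the expectation value of that flip in `γ` is the purity `tr (M * M)` of the marginal `M` of `σ`
at the node `0`. Hence `tr (M * M) = ε` (`Network.trace_marginal_mul_self_eq`).

In the antisymmetric case `ε = -1`, which is absurd. In the symmetric case `M` is pure, and together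
with the symmetry this forces `σ = M ⊗ ⋯ ⊗ M` (`eq_piTensor_marginal`). The flip condition passes
from `ρ` to the states `σ` for the single values of the shared randomness since the expectation
values `±1` are extremal (`trace_mul_flipAt_of_sum`). The positivity of `γ` comes from the Choi
matrices of the local channels (`tensorMap_posSemidef`).
-/

namespace QuantumNetwork

open Matrix

/-! ### Positive semidefinite matrices -/

section PosSemidef

variable {n : Type*} [Fintype n]

lemma exists_eq_conjTranspose_mul_self {A : Matrix n n ℂ} (hA : A.PosSemidef) :
    ∃ B : Matrix n n ℂ, A = Bᴴ * B := by
  classical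
  open scoped MatrixOrder in
  exact CStarAlgebra.nonneg_iff_eq_star_mul_self.mp hA.nonneg

lemma trace_mul_eq_trace_conj (B C : Matrix n n ℂ) :
    (Bᴴ * B * (Cᴴ * C)).trace = ((B * Cᴴ)ᴴ * (B * Cᴴ)).trace := by
  rw [Matrix.conjTranspose_mul, Matrix.conjTranspose_conjTranspose, Matrix.trace_mul_comm]
  rw [show Cᴴ * C * (Bᴴ * B) = Cᴴ * (C * Bᴴ * B) by simp only [Matrix.mul_assoc],
    Matrix.trace_mul_comm]
  simp only [Matrix.mul_assoc]

lemma trace_mul_nonneg {A B : Matrix n n ℂ} (hA : A.PosSemidef) (hB : B.PosSemidef) :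
    0 ≤ (A * B).trace := by
  obtain ⟨U, rfl⟩ := exists_eq_conjTranspose_mul_self hA
  obtain ⟨V, rfl⟩ := exists_eq_conjTranspose_mul_self hB
  rw [trace_mul_eq_trace_conj]
  exact (posSemidef_conjTranspose_mul_self _).trace_nonneg

lemma mul_eq_zero_of_trace_mul_eq_zero {A B : Matrix n n ℂ} (hA : A.PosSemidef)
    (hB : B.PosSemidef) (h : (A * B).trace = 0) : A * B = 0 := by
  obtain ⟨U, rfl⟩ := exists_eq_conjTranspose_mul_self hA
  obtain ⟨V, rfl⟩ := exists_eq_conjTranspose_mul_self hB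
  rw [trace_mul_eq_trace_conj, trace_conjTranspose_mul_self_eq_zero_iff] at h
  rw [show Uᴴ * U * (Vᴴ * V) = Uᴴ * (U * Vᴴ) * V by simp only [Matrix.mul_assoc], h]
  simp

/-- A density matrix is at most the identity, since its eigenvalues are nonnegative with sum `1`. -/
lemma IsDensity.one_sub_posSemidef {n : Type} [Fintype n] [DecidableEq n] {A : Matrix n n ℂ}
    (hA : IsDensity A) : (1 - A).PosSemidef := by
  have hH := hA.1.isHermitian
  have hsum : ∑ i, hH.eigenvalues i = 1 := by
    have := hH.trace_eq_sum_eigenvalues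
    rw [hA.2] at this
    simpa using (congrArg Complex.re this).symm
  have hle : ∀ i, hH.eigenvalues i ≤ 1 := fun i => by
    rw [← hsum]
    exact Finset.single_le_sum (fun j _ => hA.1.eigenvalues_nonneg j) (Finset.mem_univ i)
  have hd : (diagonal (fun i => ((1 - hH.eigenvalues i : ℝ) : ℂ))).PosSemidef :=
    PosSemidef.diagonal fun i => by
      change (0 : ℂ) ≤ _
      exact_mod_cast sub_nonneg.mpr (hle i)
  have key : (1 - A) = (hH.eigenvectorUnitary : Matrix n n ℂ) *
      diagonal (fun i => ((1 - hH.eigenvalues i : ℝ) : ℂ)) *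
      (hH.eigenvectorUnitary : Matrix n n ℂ)ᴴ := by
    have hdiag : diagonal (fun i => ((1 - hH.eigenvalues i : ℝ) : ℂ)) =
        1 - diagonal (RCLike.ofReal ∘ hH.eigenvalues) := by
      rw [← diagonal_one, diagonal_sub]
      congr 1
      ext i
      simp
    rw [hdiag, mul_sub, sub_mul, mul_one]
    have h1 : (hH.eigenvectorUnitary : Matrix n n ℂ) * (hH.eigenvectorUnitary : Matrix n n ℂ)ᴴ = 1 :=
      Unitary.coe_mul_star_self hH.eigenvectorUnitary
    rw [h1]
    congr 1
    conv_lhs => rw [hH.spectral_theorem]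
    rfl
  rw [key]
  exact hd.mul_mul_conjTranspose_same _

end PosSemidef

/-! ### Tensor products of matrices -/

section PiTensor

variable {ι : Type} [Fintype ι] {α : ι → Type}

lemma piTensor_mul [DecidableEq ι] [∀ i, Fintype (α i)] (A B : ∀ i, Matrix (α i) (α i) ℂ) :
    piTensor A * piTensor B = piTensor fun i => A i * B i := by
  ext x y
  simp only [piTensor, Matrix.mul_apply, Matrix.of_apply, ← Finset.prod_mul_distrib]
  exact (Fintype.prod_sum fun i z => A i (x i) z * B i z (y i)).symm

lemma piTensor_conjTranspose (A : ∀ i, Matrix (α i) (α i) ℂ) :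
    (piTensor A)ᴴ = piTensor fun i => (A i)ᴴ := by
  ext x y
  simp [piTensor, Matrix.conjTranspose_apply]

lemma trace_piTensor [DecidableEq ι] [∀ i, Fintype (α i)] (A : ∀ i, Matrix (α i) (α i) ℂ) :
    (piTensor A).trace = ∏ i, (A i).trace := by
  simp only [piTensor, Matrix.trace, Matrix.diag, Matrix.of_apply]
  exact (Fintype.prod_sum fun i z => A i z z).symm

lemma piTensor_one [∀ i, DecidableEq (α i)] :
    piTensor (fun i => (1 : Matrix (α i) (α i) ℂ)) = 1 := by
  classical
  ext x y
  simp only [piTensor, Matrix.of_apply, Matrix.one_apply]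
  rw [Finset.prod_ite_zero]
  simp [funext_iff]

lemma piTensor_posSemidef [∀ i, Fintype (α i)] {A : ∀ i, Matrix (α i) (α i) ℂ}
    (hA : ∀ i, (A i).PosSemidef) : (piTensor A).PosSemidef := by
  classical
  choose B hB using fun i => exists_eq_conjTranspose_mul_self (hA i)
  rw [show A = fun i => (B i)ᴴ * B i from funext hB, ← piTensor_mul, ← piTensor_conjTranspose]
  exact posSemidef_conjTranspose_mul_self _

lemma IsDensity.piTensor [DecidableEq ι] [∀ i, Fintype (α i)] {A : ∀ i, Matrix (α i) (α i) ℂ}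
    (hA : ∀ i, IsDensity (A i)) : IsDensity (piTensor A) :=
  ⟨piTensor_posSemidef fun i => (hA i).1, by simp [trace_piTensor, (hA _).2]⟩

end PiTensor

/-! ### Tensor products of channels -/

section TensorMap

variable {ι : Type} [Fintype ι] [DecidableEq ι] {α β : ι → Type}
  [∀ i, Fintype (α i)] [∀ i, DecidableEq (α i)] [∀ i, Fintype (β i)]

/-- The Choi matrix of a channel is positive semidefinite. -/
lemma IsChannel.choi_posSemidef {α β : Type} [Fintype α] [DecidableEq α] [Fintype β]
    {E : Matrix α α ℂ →ₗ[ℂ] Matrix β β ℂ} (hE : IsChannel E) :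
    (Matrix.of fun p q : α × β => E (single p.1 q.1 1) p.2 q.2).PosSemidef := by
  let e := Fintype.equivFin α
  -- the unnormalised maximally entangled vector
  let v : Fin (Fintype.card α) × α → ℂ := fun p => if e p.2 = p.1 then 1 else 0
  have h := (hE.1 _ _ (posSemidef_vecMulVec_self_star v)).submatrix
    (fun p : α × β => (e p.1, p.2))
  convert h using 1
  ext p q
  simp only [Matrix.of_apply, Matrix.submatrix_apply, ampliation]
  refine congrFun₂ (congrArg E ?_) _ _
  ext a b
  simp only [v, Matrix.single_apply, Matrix.of_apply, vecMulVec_apply, e.apply_eq_iff_eq,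
    Pi.star_apply, apply_ite star, star_one, star_zero]
  by_cases h1 : p.1 = a <;> by_cases h2 : q.1 = b <;> simp [h1, h2, eq_comm (a := a) (b := p.1),
    eq_comm (a := b) (b := q.1)]

/-- A tensor product of channels is positive: with `C i` the Choi matrix of `E i`, the matrix
`tensorMap E X` is a compression of the tensor product of `X` and all the `C i`. -/
lemma tensorMap_posSemidef {E : ∀ i, Matrix (α i) (α i) ℂ →ₗ[ℂ] Matrix (β i) (β i) ℂ}
    (hE : ∀ i, IsChannel (E i)) {X : Matrix (∀ i, α i) (∀ i, α i) ℂ} (hX : X.PosSemidef) :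
    (tensorMap E X).PosSemidef := by
  classical
  have hC := piTensor_posSemidef fun i => (hE i).choi_posSemidef
  have hK := (hX.kronecker hC).submatrix
    (fun p : (∀ i, α i) × (∀ i, β i) => (p.1, fun i => (p.1 i, p.2 i)))
  have h := hK.conjTranspose_mul_mul_same
    (Matrix.of fun (p : (∀ i, α i) × (∀ i, β i)) (b : ∀ i, β i) => if p.2 = b then (1 : ℂ) else 0)
  refine Eq.subst (motive := Matrix.PosSemidef) ?_ h
  ext b c
  simp only [Matrix.mul_apply, Fintype.sum_prod_type, Matrix.conjTranspose_apply, Matrix.of_apply,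
    apply_ite star, star_one, star_zero, ite_mul, mul_ite, one_mul, mul_one, zero_mul, mul_zero,
    Finset.sum_ite_eq', Finset.mem_univ, if_true, Matrix.submatrix_apply, kroneckerMap_apply,
    tensorMap, Matrix.sum_apply, Matrix.smul_apply, smul_eq_mul, piTensor]
  exact Finset.sum_comm

lemma trace_tensorMap_mul_piTensor
    (E : ∀ i, Matrix (α i) (α i) ℂ →ₗ[ℂ] Matrix (β i) (β i) ℂ)
    (X : Matrix (∀ i, α i) (∀ i, α i) ℂ) (O : ∀ i, Matrix (β i) (β i) ℂ) :
    (tensorMap E X * piTensor O).trace =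
      ∑ x, ∑ y, X x y * ∏ i, (E i (single (x i) (y i) 1) * O i).trace := by
  simp only [tensorMap, Finset.sum_mul, Matrix.trace_sum, Matrix.smul_mul, Matrix.trace_smul,
    piTensor_mul, trace_piTensor, smul_eq_mul]

lemma trace_tensorMap {E : ∀ i, Matrix (α i) (α i) ℂ →ₗ[ℂ] Matrix (β i) (β i) ℂ}
    (hE : ∀ i, IsChannel (E i)) (X : Matrix (∀ i, α i) (∀ i, α i) ℂ) :
    (tensorMap E X).trace = X.trace := by
  have h : ∀ x y : ∀ i, α i, ∏ i, (E i (single (x i) (y i) 1)).trace = if x = y then 1 else 0 := by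
    intro x y
    rw [← Matrix.one_apply (α := ℂ), ← piTensor_one]
    simp only [piTensor, Matrix.of_apply, (hE _).2, Matrix.one_apply]
    refine Finset.prod_congr rfl fun i _ => ?_
    split_ifs with hi
    · rw [hi, trace_single_eq_same]
    · exact trace_single_eq_of_ne _ _ _ hi
  simp only [tensorMap, Matrix.trace_sum, Matrix.trace_smul, trace_piTensor, h]
  simp [Matrix.trace]

end TensorMap

/-! ### Flip operators and local observables -/

lemma comp_swap_eq_iff {ι κ : Type*} [DecidableEq ι] {a b : ι} {x y : ι → κ} :
    x = y ∘ Equiv.swap a b ↔ y = x ∘ Equiv.swap a b := by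
  constructor <;> rintro rfl <;> ext i <;> simp

section Flip

variable {ι : Type} [Fintype ι] [DecidableEq ι] {d : ℕ}

/-- The flip operator exchanging the tensor factors `a` and `b`, for an arbitrary index type of
parties. -/
def flipAt (a b : ι) : Matrix (ι → Fin d) (ι → Fin d) ℂ :=
  Matrix.of fun x y => if x = y ∘ Equiv.swap a b then 1 else 0

/-- The observable `O` of party `a`, tensored with the identity on all other parties. -/
def localObs (a : ι) (O : Matrix (Fin d) (Fin d) ℂ) : ι → Matrix (Fin d) (Fin d) ℂ :=
  Function.update 1 a O

/-- The observable `O` of party `a` and `O'` of party `b`, with the identity elsewhere. -/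
def pairObs (a b : ι) (O O' : Matrix (Fin d) (Fin d) ℂ) : ι → Matrix (Fin d) (Fin d) ℂ :=
  Function.update (localObs a O) b O'

lemma flipAt_conjTranspose (a b : ι) :
    (flipAt a b : Matrix (ι → Fin d) (ι → Fin d) ℂ)ᴴ = flipAt a b := by
  ext x y
  simp only [flipAt, Matrix.conjTranspose_apply, Matrix.of_apply, apply_ite star, star_one,
    star_zero]
  exact if_congr comp_swap_eq_iff rfl rfl

lemma mul_flipAt_apply (M : Matrix (ι → Fin d) (ι → Fin d) ℂ) (a b : ι) (x y : ι → Fin d) :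
    (M * flipAt a b : Matrix (ι → Fin d) (ι → Fin d) ℂ) x y = M x (y ∘ Equiv.swap a b) := by
  simp [flipAt, Matrix.mul_apply]

lemma flipAt_mul_apply (M : Matrix (ι → Fin d) (ι → Fin d) ℂ) (a b : ι) (x y : ι → Fin d) :
    (flipAt a b * M : Matrix (ι → Fin d) (ι → Fin d) ℂ) x y = M (x ∘ Equiv.swap a b) y := by
  simp [flipAt, Matrix.mul_apply, comp_swap_eq_iff (x := x)]

lemma flipAt_mul_self (a b : ι) :
    (flipAt a b * flipAt a b : Matrix (ι → Fin d) (ι → Fin d) ℂ) = 1 := by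
  ext x y
  rw [mul_flipAt_apply, flipAt, Matrix.of_apply, Matrix.one_apply]
  congr 1
  simp [Function.comp_assoc, ← Equiv.coe_trans]

lemma flipAt_conj_piTensor (a b : ι) (A : ι → Matrix (Fin d) (Fin d) ℂ) :
    flipAt a b * piTensor A * flipAt a b = piTensor (A ∘ Equiv.swap a b) := by
  ext x y
  rw [mul_flipAt_apply, flipAt_mul_apply]
  simp only [piTensor, Matrix.of_apply, Function.comp]
  exact Fintype.prod_equiv (Equiv.swap a b) _ _ (by simp)

/-- Transpositions compose: `F_bc F_ab F_bc = F_ac`. -/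
lemma flipAt_mul_flipAt_mul_flipAt {a b c : ι} (hab : a ≠ b) (hac : a ≠ c) :
    (flipAt b c * flipAt a b * flipAt b c : Matrix (ι → Fin d) (ι → Fin d) ℂ) = flipAt a c := by
  ext x y
  rw [mul_flipAt_apply, flipAt_mul_apply, flipAt, flipAt, Matrix.of_apply, Matrix.of_apply]
  refine if_congr ?_ rfl rfl
  have h : ∀ i, Equiv.swap b c (Equiv.swap a b (Equiv.swap b c i)) = Equiv.swap a c i := by
    intro i
    rw [Equiv.swap_comm a c, ← Equiv.swap_mul_swap_mul_swap hab hac]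
    rfl
  simp only [funext_iff, Function.comp]
  constructor
  · intro hx i
    simpa [h] using hx (Equiv.swap b c i)
  · intro hx i
    rw [hx, ← h, Equiv.swap_apply_self]

/-- Expansion of the flip operator in product observables:
`F_ab = ∑ p q, |p⟩⟨q| ⊗ |q⟩⟨p|`. -/
lemma flipAt_eq_sum_piTensor {a b : ι} (hab : a ≠ b) :
    (flipAt a b : Matrix (ι → Fin d) (ι → Fin d) ℂ) =
      ∑ p, ∑ q, piTensor (pairObs a b (single p q 1) (single q p 1)) := by
  ext x y
  have h : ∀ p q : Fin d, piTensor (pairObs a b (single p q 1) (single q p 1)) x y =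
      if q = y a then if p = x a then if x = y ∘ Equiv.swap a b then 1 else 0 else 0 else 0 := by
    intro p q
    rw [piTensor, Matrix.of_apply, ← Finset.mul_prod_erase _ _ (Finset.mem_univ a),
      ← Finset.mul_prod_erase _ _ (show b ∈ Finset.univ.erase a by simp [hab.symm])]
    have : ∀ i ∈ (Finset.univ.erase a).erase b,
        pairObs a b (single p q 1) (single q p 1) i (x i) (y i) =
          if x i = y i then (1 : ℂ) else 0 := by
      intro i hi
      simp only [Finset.mem_erase] at hi
      simp [pairObs, localObs, hi.1, hi.2.1, Matrix.one_apply]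
    rw [Finset.prod_congr rfl this, Finset.prod_ite_zero]
    simp only [pairObs, localObs, Function.update_self, Function.update_of_ne hab,
      Matrix.single_apply, Finset.mem_erase, Finset.mem_univ, and_true, Finset.prod_const_one]
    have hxy : x = y ∘ Equiv.swap a b ↔
        x a = y b ∧ x b = y a ∧ ∀ i, i ≠ b ∧ i ≠ a → x i = y i := by
      constructor
      · rintro rfl
        refine ⟨by simp, by simp, fun i hi => ?_⟩
        simp [Equiv.swap_apply_of_ne_of_ne hi.2 hi.1]
      · rintro ⟨h1, h2, h3⟩
        ext i
        by_cases hia : i = a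
        · simp [hia, h1]
        by_cases hib : i = b
        · simp [hib, h2]
        simp [Equiv.swap_apply_of_ne_of_ne hia hib, h3 i ⟨hib, hia⟩]
    grind
  simp only [Matrix.sum_apply, h, flipAt, Matrix.of_apply, Finset.sum_ite_eq', Finset.mem_univ,
    if_true]

/-- `1 - ε F` is a multiple of a projector, for `ε = ±1`. -/
lemma one_sub_smul_flipAt_posSemidef {ε : ℂ} (hε : ε = 1 ∨ ε = -1) (a b : ι) :
    (1 - ε • flipAt a b : Matrix (ι → Fin d) (ι → Fin d) ℂ).PosSemidef := by
  have hεε : ε * ε = 1 := by rcases hε with rfl | rfl <;> simp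
  have hst : star ε = ε := by rcases hε with rfl | rfl <;> simp
  have h : (1 - ε • flipAt a b : Matrix (ι → Fin d) (ι → Fin d) ℂ) =
      (1 / 2 : ℝ) • ((1 - ε • flipAt a b)ᴴ * (1 - ε • flipAt a b)) := by
    rw [conjTranspose_sub, conjTranspose_smul, flipAt_conjTranspose, hst, conjTranspose_one,
      mul_sub, sub_mul, sub_mul, Matrix.smul_mul, Matrix.mul_smul, Matrix.smul_mul,
      Matrix.mul_smul, flipAt_mul_self, smul_smul, hεε]
    simp only [Matrix.one_mul, Matrix.mul_one, one_smul]
    module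
  rw [h]
  exact (posSemidef_conjTranspose_mul_self _).smul (by norm_num)

/-- If a state has expectation value `ε = ±1` for a flip, it is an eigenvector of that flip. -/
lemma mul_flipAt_eq_smul {A : Matrix (ι → Fin d) (ι → Fin d) ℂ} (hA : IsDensity A) {ε : ℂ}
    (hε : ε = 1 ∨ ε = -1) {a b : ι} (h : (A * flipAt a b).trace = ε) :
    A * flipAt a b = ε • A := by
  have hεε : ε * ε = 1 := by rcases hε with rfl | rfl <;> simp
  have h0 := mul_eq_zero_of_trace_mul_eq_zero hA.1 (one_sub_smul_flipAt_posSemidef hε a b) (by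
    rw [mul_sub, Matrix.mul_one, Matrix.mul_smul, Matrix.trace_sub, Matrix.trace_smul, h, hA.2,
      smul_eq_mul, hεε, sub_self])
  rw [mul_sub, Matrix.mul_one, Matrix.mul_smul, sub_eq_zero] at h0
  conv_rhs => rw [h0]
  rw [smul_smul, hεε, one_smul]

/-- Being a `±1` eigenvector of flips is transitive along pairs of parties. -/
lemma mul_flipAt_trans {A : Matrix (ι → Fin d) (ι → Fin d) ℂ} {ε : ℂ} (hε : ε = 1 ∨ ε = -1)
    {a b c : ι} (hab : a ≠ b) (hac : a ≠ c) (h : A * flipAt a b = ε • A)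
    (h' : A * flipAt b c = ε • A) : A * flipAt a c = ε • A := by
  rw [← flipAt_mul_flipAt_mul_flipAt hab hac, ← Matrix.mul_assoc, ← Matrix.mul_assoc, h',
    Matrix.smul_mul, h, Matrix.smul_mul, Matrix.smul_mul, h', smul_smul, smul_smul]
  rcases hε with rfl | rfl <;> simp

/-! ### Marginals of single parties -/

lemma piTensor_localObs (a : ι) (O : Matrix (Fin d) (Fin d) ℂ) :
    piTensor (localObs a O) = ∑ p, ∑ q, O p q • piTensor (localObs a (single p q 1)) := by
  ext x y
  have h : ∀ O : Matrix (Fin d) (Fin d) ℂ, piTensor (localObs a O) x y =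
      O (x a) (y a) * ∏ i ∈ Finset.univ.erase a, (1 : Matrix (Fin d) (Fin d) ℂ) (x i) (y i) := by
    intro O
    rw [piTensor, Matrix.of_apply, ← Finset.mul_prod_erase _ _ (Finset.mem_univ a)]
    congr 1
    · simp [localObs]
    · exact Finset.prod_congr rfl fun i hi => by simp [localObs, Finset.ne_of_mem_erase hi]
  simp only [Matrix.sum_apply, Matrix.smul_apply, h, smul_eq_mul, single_apply, ite_and,
    ite_mul, mul_ite, zero_mul, mul_zero, one_mul]
  simp

lemma piTensor_localObs_one (a : ι) :
    piTensor (localObs a (1 : Matrix (Fin d) (Fin d) ℂ)) = 1 := by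
  rw [← piTensor_one, localObs]
  exact congrArg piTensor (Function.update_eq_self a 1)

lemma localObs_posSemidef (a : ι) {O : Matrix (Fin d) (Fin d) ℂ} (hO : O.PosSemidef) :
    (piTensor (localObs a O)).PosSemidef :=
  piTensor_posSemidef fun i => by
    by_cases h : i = a
    · subst h
      simpa [localObs] using hO
    · simpa [localObs, h] using PosSemidef.one

/-- The reduced state of party `a`, whose entries are the expectation values of matrix units. -/
def marginal (A : Matrix (ι → Fin d) (ι → Fin d) ℂ) (a : ι) : Matrix (Fin d) (Fin d) ℂ :=
  Matrix.of fun p q => (A * piTensor (localObs a (single q p 1))).trace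

lemma trace_marginal_mul (A : Matrix (ι → Fin d) (ι → Fin d) ℂ) (a : ι)
    (O : Matrix (Fin d) (Fin d) ℂ) :
    (marginal A a * O).trace = (A * piTensor (localObs a O)).trace := by
  rw [piTensor_localObs]
  simp only [Matrix.mul_sum, Matrix.mul_smul, Matrix.trace_sum, Matrix.trace_smul, smul_eq_mul]
  rw [Finset.sum_comm]
  have h : (marginal A a * O).trace = ∑ q, ∑ p, marginal A a q p * O p q := rfl
  rw [h]
  simp only [marginal, Matrix.of_apply, mul_comm]

lemma IsDensity.marginal {A : Matrix (ι → Fin d) (ι → Fin d) ℂ} (hA : IsDensity A) (a : ι) :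
    IsDensity (marginal A a) := by
  refine ⟨posSemidef_iff_dotProduct_mulVec.mpr ⟨?_, fun v => ?_⟩, ?_⟩
  · ext p q
    simp only [Matrix.conjTranspose_apply, QuantumNetwork.marginal, Matrix.of_apply]
    rw [← Matrix.trace_conjTranspose, Matrix.conjTranspose_mul, hA.1.isHermitian.eq,
      piTensor_conjTranspose, Matrix.trace_mul_comm]
    congr 3
    ext i : 1
    by_cases h : i = a
    · subst h
      simp [localObs]
    · simp [localObs, h]
  · have h : star v ⬝ᵥ QuantumNetwork.marginal A a *ᵥ v =
        (QuantumNetwork.marginal A a * vecMulVec v (star v)).trace := by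
      rw [Matrix.mul_vecMulVec, trace_vecMulVec, dotProduct_comm]
    rw [h, trace_marginal_mul]
    exact trace_mul_nonneg hA.1 (localObs_posSemidef a (posSemidef_vecMulVec_self_star v))
  · rw [← Matrix.mul_one (QuantumNetwork.marginal A a), trace_marginal_mul, piTensor_localObs_one,
      Matrix.mul_one, hA.2]

/-- Two density matrices whose overlap is `1` coincide. -/
lemma IsDensity.eq_of_trace_mul_eq_one {n : Type} [Fintype n] {A B : Matrix n n ℂ}
    (hA : IsDensity A) (hB : IsDensity B) (h : (A * B).trace = 1) : A = B := by
  classical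
  have hsq : ∀ {C : Matrix n n ℂ}, IsDensity C → (C * C).trace ≤ 1 := fun {C} hC => by
    have := trace_mul_nonneg hC.1 hC.one_sub_posSemidef
    rwa [mul_sub, Matrix.mul_one, Matrix.trace_sub, hC.2, sub_nonneg] at this
  have hH : (A - B)ᴴ = A - B := by
    rw [conjTranspose_sub, hA.1.isHermitian.eq, hB.1.isHermitian.eq]
  have h0 : ((A - B)ᴴ * (A - B)).trace ≤ 0 := by
    rw [hH, sub_mul, mul_sub, mul_sub, Matrix.trace_sub, Matrix.trace_sub, Matrix.trace_sub,
      Matrix.trace_mul_comm B A, h]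
    have := add_le_add (hsq hA) (hsq hB)
    calc (A * A).trace - 1 - (1 - (B * B).trace) = (A * A).trace + (B * B).trace - (1 + 1) := by
          ring
      _ ≤ 0 := sub_nonpos.mpr this
  have h1 := le_antisymm h0 (posSemidef_conjTranspose_mul_self _).trace_nonneg
  exact sub_eq_zero.mp (trace_conjTranspose_mul_self_eq_zero_iff.mp h1)

end Flip

/-! ### The cut inflation of a network -/

namespace Network

variable {N d : ℕ} {G : Network N} {dim : Fin G.numSources → Fin N → ℕ}

/-- The labels received by the node `n` when the sources emit the labels `ξ`. -/
def received (ξ : ∀ s, G.SourceSys dim s) (n : Fin N) : G.NodeSys dim n :=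
  fun s => ξ s.1 ⟨n, s.2⟩

lemma received_congr {ξ η : ∀ s, G.SourceSys dim s} {n : Fin N}
    (h : ∀ s, n ∈ G.conn s → ξ s = η s) : received ξ n = received η n := by
  funext s
  rw [received, received, h s.1 s.2]

/-- The matrix element of the local channel `E n`, with labels read off from `ξ` and `η`,
paired with the observable `O`. -/
def nodeValue (E : ∀ n, Matrix (G.NodeSys dim n) (G.NodeSys dim n) ℂ →ₗ[ℂ]
    Matrix (Fin d) (Fin d) ℂ) (n : Fin N) (O : Matrix (Fin d) (Fin d) ℂ)
    (ξ η : ∀ s, G.SourceSys dim s) : ℂ :=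
  (E n (single (received ξ n) (received η n) 1) * O).trace

variable {E : ∀ n, Matrix (G.NodeSys dim n) (G.NodeSys dim n) ℂ →ₗ[ℂ] Matrix (Fin d) (Fin d) ℂ}

lemma nodeValue_congr {n : Fin N} {O : Matrix (Fin d) (Fin d) ℂ}
    {ξ η ξ' η' : ∀ s, G.SourceSys dim s} (h : ∀ s, n ∈ G.conn s → ξ s = ξ' s)
    (h' : ∀ s, n ∈ G.conn s → η s = η' s) : nodeValue E n O ξ η = nodeValue E n O ξ' η' := by
  rw [nodeValue, nodeValue, received_congr h, received_congr h']

lemma nodeValue_one (hE : ∀ n, IsChannel (E n)) (n : Fin N) (ξ η : ∀ s, G.SourceSys dim s) :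
    nodeValue E n 1 ξ η = if received ξ n = received η n then 1 else 0 := by
  rw [nodeValue, Matrix.mul_one, (hE n).2]
  split_ifs with h
  · rw [h, trace_single_eq_same]
  · exact trace_single_eq_of_ne _ _ _ h

/-- Grouping by source and grouping by node are equivalent. -/
def receivedEquiv (dim : Fin G.numSources → Fin N → ℕ) :
    (∀ s, G.SourceSys dim s) ≃ ∀ n, G.NodeSys dim n where
  toFun := received
  invFun := G.regroup dim
  left_inv _ := rfl
  right_inv _ := rfl

lemma trace_tensorMap_globalState_mul
    (src : ∀ s, Matrix (G.SourceSys dim s) (G.SourceSys dim s) ℂ)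
    (O : Fin N → Matrix (Fin d) (Fin d) ℂ) :
    (tensorMap E (G.globalState dim src) * piTensor O).trace =
      ∑ ξ : ∀ s, G.SourceSys dim s, ∑ η : ∀ s, G.SourceSys dim s,
        (∏ s, src s (ξ s) (η s)) * ∏ n, nodeValue E n (O n) ξ η := by
  rw [trace_tensorMap_mul_piTensor, ← (receivedEquiv dim).sum_comp]
  refine Finset.sum_congr rfl fun ξ _ => ?_
  rw [← (receivedEquiv dim).sum_comp]
  rfl

lemma globalState_isDensity {src : ∀ s, Matrix (G.SourceSys dim s) (G.SourceSys dim s) ℂ}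
    (hsrc : ∀ s, IsDensity (src s)) : IsDensity (G.globalState dim src) := by
  refine ⟨(piTensor_posSemidef fun s => (hsrc s).1).submatrix _, ?_⟩
  rw [← (IsDensity.piTensor hsrc).2, globalState]
  exact (receivedEquiv dim).symm.sum_comp fun ξ => piTensor src ξ ξ

/-- Source by source, the label of the first (`false`) or second (`true`) copy of the sources. -/
def pick (c : Fin G.numSources → Bool)
    (ξ : (∀ s, G.SourceSys dim s) × (∀ s, G.SourceSys dim s)) : ∀ s, G.SourceSys dim s :=
  fun s => bif c s then ξ.2 s else ξ.1 s

/-- Exchange the two copies of those sources `s` for which `c s` holds. -/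
def cross (c : Fin G.numSources → Bool) :
    ((∀ s, G.SourceSys dim s) × (∀ s, G.SourceSys dim s)) ≃
      ((∀ s, G.SourceSys dim s) × (∀ s, G.SourceSys dim s)) where
  toFun ξ := (pick c ξ, pick (fun s => !c s) ξ)
  invFun ξ := (pick c ξ, pick (fun s => !c s) ξ)
  left_inv ξ := by
    ext s : 2 <;> cases h : c s <;> simp [pick, h]
  right_inv ξ := by
    ext s : 2 <;> cases h : c s <;> simp [pick, h]

lemma pick_cross (c c' : Fin G.numSources → Bool)
    (ξ : (∀ s, G.SourceSys dim s) × (∀ s, G.SourceSys dim s)) :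
    pick c (cross c' ξ) = pick (fun s => c s ^^ c' s) ξ := by
  funext s
  cases h : c s <;> cases h' : c' s <;> simp [pick, cross, h, h']

/-- The wiring of the inflation: the copy of the source `s` to which the copy `x.2` of the node
`x.1` is connected. The ring of the `2 N` node copies is cut just before both copies of `m s`,
which is meant to be a node that `s` is not connected to. -/
def wiring (m : Fin G.numSources → Fin N) (x : Fin N × Bool) (s : Fin G.numSources) : Bool :=
  x.2 ^^ decide (x.1 < m s)

/-- The labels emitted by the two copies of all sources, regrouped by the copies of the nodes. -/
def inflationEquiv (dim : Fin G.numSources → Fin N → ℕ) (m : Fin G.numSources → Fin N) :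
    ((∀ s, G.SourceSys dim s) × (∀ s, G.SourceSys dim s)) ≃
      ∀ x : Fin N × Bool, G.NodeSys dim x.1 where
  toFun ξ x := received (pick (wiring m x) ξ) x.1
  invFun z := (fun s i => z (i, decide (i.1 < m s)) ⟨s, i.2⟩,
    fun s i => z (i, !decide (i.1 < m s)) ⟨s, i.2⟩)
  left_inv ξ := by
    ext s i : 3 <;> simp [received, pick, wiring]
  right_inv z := by
    funext ⟨n, e⟩ s
    have key : ∀ e', e' = e → z (n, e') s = z (n, e) s := by
      rintro _ rfl
      rfl
    by_cases h : n < m s <;> cases e <;> simp only [received, pick, wiring, h, decide_true,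
      decide_false, Bool.xor_true, Bool.xor_false, Bool.not_true, Bool.not_false, cond_true,
      cond_false] <;> exact key _ (by simp [h])

/-- The state emitted by two copies of all sources, grouped by the copies of the nodes. -/
def inflatedGlobalState (m : Fin G.numSources → Fin N)
    (src : ∀ s, Matrix (G.SourceSys dim s) (G.SourceSys dim s) ℂ) :
    Matrix (∀ x : Fin N × Bool, G.NodeSys dim x.1) (∀ x : Fin N × Bool, G.NodeSys dim x.1) ℂ :=
  (kroneckerMap (· * ·) (piTensor src) (piTensor src)).submatrix
    (inflationEquiv dim m).symm (inflationEquiv dim m).symm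

/-- The state generated by the inflated network: two copies of each source, and two copies of each
node, both applying the channel of the original node. -/
def inflation (E : ∀ n, Matrix (G.NodeSys dim n) (G.NodeSys dim n) ℂ →ₗ[ℂ]
    Matrix (Fin d) (Fin d) ℂ) (m : Fin G.numSources → Fin N)
    (src : ∀ s, Matrix (G.SourceSys dim s) (G.SourceSys dim s) ℂ) :
    Matrix (Fin N × Bool → Fin d) (Fin N × Bool → Fin d) ℂ :=
  tensorMap (fun x : Fin N × Bool => E x.1) (inflatedGlobalState m src)

variable {src : ∀ s, Matrix (G.SourceSys dim s) (G.SourceSys dim s) ℂ}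
  {m : Fin G.numSources → Fin N}

lemma trace_inflation_mul (O : Fin N × Bool → Matrix (Fin d) (Fin d) ℂ) :
    (inflation E m src * piTensor O).trace =
      ∑ ξ : (∀ s, G.SourceSys dim s) × (∀ s, G.SourceSys dim s),
      ∑ η : (∀ s, G.SourceSys dim s) × (∀ s, G.SourceSys dim s),
        (∏ s, src s (ξ.1 s) (η.1 s) * src s (ξ.2 s) (η.2 s)) *
          ∏ x : Fin N × Bool,
            nodeValue E x.1 (O x) (pick (wiring m x) ξ) (pick (wiring m x) η) := by
  rw [inflation, trace_tensorMap_mul_piTensor, ← (inflationEquiv dim m).sum_comp]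
  refine Finset.sum_congr rfl fun ξ _ => ?_
  rw [← (inflationEquiv dim m).sum_comp]
  refine Finset.sum_congr rfl fun η _ => ?_
  congr 1
  simp [inflatedGlobalState, kroneckerMap_apply, piTensor, Finset.prod_mul_distrib]

/-- If, after exchanging the copies of some sources, the observables of the two copies of each node
factorise over the two copies of the sources, the expectation value in the inflation is a product
of expectation values in the original network. -/
lemma trace_inflation_mul_of_factor (c : Fin G.numSources → Bool)
    {O : Fin N × Bool → Matrix (Fin d) (Fin d) ℂ} {P Q : Fin N → Matrix (Fin d) (Fin d) ℂ}
    (h : ∀ (n : Fin N) (ξ η : (∀ s, G.SourceSys dim s) × (∀ s, G.SourceSys dim s)),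
      nodeValue E n (O (n, true)) (pick (fun s => wiring m (n, true) s ^^ c s) ξ)
          (pick (fun s => wiring m (n, true) s ^^ c s) η) *
        nodeValue E n (O (n, false)) (pick (fun s => wiring m (n, false) s ^^ c s) ξ)
          (pick (fun s => wiring m (n, false) s ^^ c s) η) =
      nodeValue E n (P n) ξ.1 η.1 * nodeValue E n (Q n) ξ.2 η.2) :
    (inflation E m src * piTensor O).trace =
      (tensorMap E (G.globalState dim src) * piTensor P).trace *
        (tensorMap E (G.globalState dim src) * piTensor Q).trace := by
  rw [trace_inflation_mul, trace_tensorMap_globalState_mul, trace_tensorMap_globalState_mul,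
    Finset.sum_mul_sum, ← (cross c).sum_comp, Fintype.sum_prod_type]
  refine Finset.sum_congr rfl fun ξ₁ _ => Finset.sum_congr rfl fun ξ₂ _ => ?_
  rw [Finset.sum_mul_sum, ← (cross c).sum_comp, Fintype.sum_prod_type]
  refine Finset.sum_congr rfl fun η₁ _ => Finset.sum_congr rfl fun η₂ _ => ?_
  have hsrc : ∀ s, src s ((cross c (ξ₁, ξ₂)).1 s) ((cross c (η₁, η₂)).1 s) *
      src s ((cross c (ξ₁, ξ₂)).2 s) ((cross c (η₁, η₂)).2 s) =
      src s (ξ₁ s) (η₁ s) * src s (ξ₂ s) (η₂ s) := by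
    intro s
    cases hc : c s <;> simp [cross, pick, hc, mul_comm]
  simp only [hsrc, pick_cross, Fintype.prod_prod_type, Fintype.prod_bool, h,
    Finset.prod_mul_distrib]
  ring

lemma wiring_not (m : Fin G.numSources → Fin N) (n : Fin N) (s : Fin G.numSources) :
    wiring m (n, true) s = !wiring m (n, false) s := by
  simp [wiring]

/-- Nodes without observable factorise, whatever copies of the sources they are wired to. -/
lemma nodeValue_one_mul_nodeValue_one (hE : ∀ n, IsChannel (E n)) (n : Fin N)
    (c : Fin G.numSources → Bool)
    (ξ η : (∀ s, G.SourceSys dim s) × (∀ s, G.SourceSys dim s)) :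
    nodeValue E n 1 (pick (fun s => wiring m (n, true) s ^^ c s) ξ)
          (pick (fun s => wiring m (n, true) s ^^ c s) η) *
        nodeValue E n 1 (pick (fun s => wiring m (n, false) s ^^ c s) ξ)
          (pick (fun s => wiring m (n, false) s ^^ c s) η) =
      nodeValue E n 1 ξ.1 η.1 * nodeValue E n 1 ξ.2 η.2 := by
  simp only [nodeValue_one hE, ite_zero_mul_ite_zero]
  refine if_congr ?_ rfl rfl
  simp only [funext_iff, received, ← forall_and]
  refine forall_congr' fun s => ?_
  cases hc : c s.1 <;> cases h : wiring m (n, false) s <;>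
    simp [pick, wiring_not, hc, h, and_comm]

/-- A node copy that is wired to the sources' copies selected by `c` sees the first labels. -/
lemma nodeValue_pick {n : Fin N} {e : Bool} {c : Fin G.numSources → Bool}
    (hc : ∀ s, n ∈ G.conn s → c s = wiring m (n, e) s) (O : Matrix (Fin d) (Fin d) ℂ)
    (ξ η : (∀ s, G.SourceSys dim s) × (∀ s, G.SourceSys dim s)) :
    nodeValue E n O (pick (fun s => wiring m (n, e) s ^^ c s) ξ)
      (pick (fun s => wiring m (n, e) s ^^ c s) η) = nodeValue E n O ξ.1 η.1 :=
  nodeValue_congr (fun s hs => by simp [pick, hc s hs]) fun s hs => by simp [pick, hc s hs]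

/-- A node copy that is not wired to the sources' copies selected by `c` sees the second labels. -/
lemma nodeValue_pick_not {n : Fin N} {e : Bool} {c : Fin G.numSources → Bool}
    (hc : ∀ s, n ∈ G.conn s → c s = !wiring m (n, e) s) (O : Matrix (Fin d) (Fin d) ℂ)
    (ξ η : (∀ s, G.SourceSys dim s) × (∀ s, G.SourceSys dim s)) :
    nodeValue E n O (pick (fun s => wiring m (n, e) s ^^ c s) ξ)
      (pick (fun s => wiring m (n, e) s ^^ c s) η) = nodeValue E n O ξ.2 η.2 :=
  nodeValue_congr (fun s hs => by simp [pick, hc s hs]) fun s hs => by simp [pick, hc s hs]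

/-- If `c` selects the sources' copies used by the copy `e` of the node `n`, an observable of this
copy of the node factorises. -/
lemma nodeValue_mul_nodeValue {n : Fin N} {e : Bool} {c : Fin G.numSources → Bool}
    (hc : ∀ s, n ∈ G.conn s → c s = wiring m (n, e) s) (O : Bool → Matrix (Fin d) (Fin d) ℂ)
    (ξ η : (∀ s, G.SourceSys dim s) × (∀ s, G.SourceSys dim s)) :
    nodeValue E n (O true) (pick (fun s => wiring m (n, true) s ^^ c s) ξ)
          (pick (fun s => wiring m (n, true) s ^^ c s) η) *
        nodeValue E n (O false) (pick (fun s => wiring m (n, false) s ^^ c s) ξ)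
          (pick (fun s => wiring m (n, false) s ^^ c s) η) =
      nodeValue E n (O e) ξ.1 η.1 * nodeValue E n (O (!e)) ξ.2 η.2 := by
  cases e
  · rw [nodeValue_pick hc, nodeValue_pick_not fun s hs => by rw [hc s hs, wiring_not, Bool.not_not],
      mul_comm]
    rfl
  · rw [nodeValue_pick hc, nodeValue_pick_not fun s hs => by rw [hc s hs, wiring_not]]
    rfl

lemma inflation_isDensity (hE : ∀ n, IsChannel (E n)) (hsrc : ∀ s, IsDensity (src s)) :
    IsDensity (inflation E m src) := by
  have hpi := IsDensity.piTensor hsrc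
  refine ⟨tensorMap_posSemidef (fun x => hE x.1) ((hpi.1.kronecker hpi.1).submatrix _), ?_⟩
  rw [inflation, trace_tensorMap fun x : Fin N × Bool => hE x.1]
  have h := (inflationEquiv dim m).symm.sum_comp fun ξ =>
    kroneckerMap (· * ·) (piTensor src) (piTensor src) ξ ξ
  refine h.trans ?_
  have h2 := trace_kronecker (piTensor src) (piTensor src)
  rw [hpi.2, one_mul] at h2
  exact h2

/-- Node copies that agree on the copies of their common sources have the same joint reduced state
as in the original network. -/
lemma trace_inflation_mul_pairObs (hE : ∀ n, IsChannel (E n)) {a b : Fin N × Bool}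
    (hab : a.1 ≠ b.1)
    (hlink : ∀ s, a.1 ∈ G.conn s → b.1 ∈ G.conn s → wiring m a s = wiring m b s)
    (O O' : Matrix (Fin d) (Fin d) ℂ) :
    (inflation E m src * piTensor (pairObs a b O O')).trace =
      (tensorMap E (G.globalState dim src) * piTensor (pairObs a.1 b.1 O O')).trace *
        (tensorMap E (G.globalState dim src)).trace := by
  rw [← Matrix.mul_one (tensorMap E (G.globalState dim src)), ← piTensor_one, Matrix.mul_assoc,
    piTensor_mul]
  simp only [Matrix.one_mul]
  -- make the copies of the sources that `a` and `b` use the first ones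
  refine trace_inflation_mul_of_factor
    (fun s => if a.1 ∈ G.conn s then wiring m a s else wiring m b s) fun n ξ η => ?_
  obtain ⟨i, e⟩ := a
  obtain ⟨j, f⟩ := b
  dsimp only at hab hlink ⊢
  by_cases hi : n = i
  · subst hi
    rw [nodeValue_mul_nodeValue (e := e) (fun s hs => if_pos hs)
      fun k => pairObs (n, e) (j, f) O O' (n, k)]
    simp [pairObs, localObs, hab]
  by_cases hj : n = j
  · subst hj
    rw [nodeValue_mul_nodeValue (e := f) (fun s hs => ?_)
      fun k => pairObs (i, e) (n, f) O O' (n, k)]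
    · simp [pairObs, localObs, hi]
    · split_ifs with h
      · exact hlink s h hs
      · rfl
  simpa [pairObs, localObs, hi, hj] using nodeValue_one_mul_nodeValue_one hE n _ ξ η

/-- The two copies of a node are uncorrelated in the inflation. -/
lemma trace_inflation_mul_pairObs_copies (hE : ∀ n, IsChannel (E n)) (n : Fin N)
    (O O' : Matrix (Fin d) (Fin d) ℂ) :
    (inflation E m src * piTensor (pairObs (n, false) (n, true) O O')).trace =
      (tensorMap E (G.globalState dim src) * piTensor (localObs n O)).trace *
        (tensorMap E (G.globalState dim src) * piTensor (localObs n O')).trace := by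
  -- make the copies of the sources that `(n, false)` uses the first ones
  refine trace_inflation_mul_of_factor (wiring m (n, false)) fun k ξ η => ?_
  by_cases hk : k = n
  · subst hk
    rw [nodeValue_mul_nodeValue (e := false) (fun s _ => rfl)
      fun l => pairObs (k, false) (k, true) O O' (k, l)]
    simp [pairObs, localObs]
  · simpa [pairObs, localObs, hk] using nodeValue_one_mul_nodeValue_one hE k _ ξ η

end Network

/-! ### Flips in the inflation -/

namespace Network

variable {N d : ℕ} {G : Network N} {dim : Fin G.numSources → Fin N → ℕ}
  {E : ∀ n, Matrix (G.NodeSys dim n) (G.NodeSys dim n) ℂ →ₗ[ℂ] Matrix (Fin d) (Fin d) ℂ}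
  {src : ∀ s, Matrix (G.SourceSys dim s) (G.SourceSys dim s) ℂ} {m : Fin G.numSources → Fin N}

lemma tensorMap_globalState_isDensity (hE : ∀ n, IsChannel (E n))
    (hsrc : ∀ s, IsDensity (src s)) : IsDensity (tensorMap E (G.globalState dim src)) :=
  ⟨tensorMap_posSemidef hE (globalState_isDensity hsrc).1, by
    rw [trace_tensorMap hE, (globalState_isDensity hsrc).2]⟩

lemma trace_inflation_mul_flipAt (hE : ∀ n, IsChannel (E n)) (hsrc : ∀ s, IsDensity (src s))
    {a b : Fin N × Bool} (hab : a.1 ≠ b.1)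
    (hlink : ∀ s, a.1 ∈ G.conn s → b.1 ∈ G.conn s → wiring m a s = wiring m b s) :
    (inflation E m src * flipAt a b).trace =
      (tensorMap E (G.globalState dim src) * flipAt a.1 b.1).trace := by
  have hab' : a ≠ b := fun h => hab (congrArg Prod.fst h)
  simp only [flipAt_eq_sum_piTensor hab, flipAt_eq_sum_piTensor hab', Matrix.mul_sum,
    Matrix.trace_sum, trace_inflation_mul_pairObs hE hab hlink,
    (tensorMap_globalState_isDensity hE hsrc).2, mul_one]

lemma trace_inflation_mul_flipAt_copies (hE : ∀ n, IsChannel (E n)) (n : Fin N) :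
    (inflation E m src * flipAt (n, false) (n, true)).trace =
      (marginal (tensorMap E (G.globalState dim src)) n *
        marginal (tensorMap E (G.globalState dim src)) n).trace := by
  have hn : (n, false) ≠ (n, true) := by simp
  simp only [flipAt_eq_sum_piTensor hn, Matrix.mul_sum, Matrix.trace_sum,
    trace_inflation_mul_pairObs_copies hE]
  exact Finset.sum_comm

/-- If a network state has expectation value `ε = ±1` for all flips, then so does its inflation for
the flip of the two copies of the first node, hence `ε` is the purity of the marginal. -/
theorem trace_marginal_mul_self_eq (hN : 2 ≤ N) (hG : ∀ s, (G.conn s).card < N)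
    (hE : ∀ n, IsChannel (E n)) (hsrc : ∀ s, IsDensity (src s)) {ε : ℂ} (hε : ε = 1 ∨ ε = -1)
    (hflip : ∀ i j : Fin N, i ≠ j →
      (tensorMap E (G.globalState dim src) * flipAt i j).trace = ε) :
    (marginal (tensorMap E (G.globalState dim src)) ⟨0, by omega⟩ *
      marginal (tensorMap E (G.globalState dim src)) ⟨0, by omega⟩).trace = ε := by
  have hmiss : ∀ s, ∃ i, i ∉ G.conn s := fun s => by
    by_contra! h
    have := hG s
    rw [Finset.eq_univ_iff_forall.mpr h, Finset.card_univ, Fintype.card_fin] at this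
    exact this.false
  choose m hm using hmiss
  have hγ : IsDensity (inflation E m src) := inflation_isDensity hE hsrc
  have hlink : ∀ a b : Fin N × Bool, a.1 ≠ b.1 →
      (∀ s, a.1 ∈ G.conn s → b.1 ∈ G.conn s → wiring m a s = wiring m b s) →
      inflation E m src * flipAt a b = ε • inflation E m src := fun a b hab h =>
    mul_flipAt_eq_smul hγ hε ((trace_inflation_mul_flipAt hE hsrc hab h).trans (hflip _ _ hab))
  have hstep : ∀ k (hk : k + 1 < N), inflation E m src *
      flipAt (⟨k, by omega⟩, false) (⟨k + 1, hk⟩, false) = ε • inflation E m src := by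
    refine fun k hk => hlink _ _ (by simp) fun s _ hs => ?_
    have hne : (m s : ℕ) ≠ k + 1 := fun h => hm s (by convert hs; exact Fin.ext h)
    simp only [wiring, Fin.lt_def, Bool.false_xor, decide_eq_decide]
    omega
  -- along the first copies of all nodes
  have hchain : ∀ k (hk : k + 1 < N), inflation E m src *
      flipAt (⟨0, by omega⟩, false) (⟨k + 1, hk⟩, false) = ε • inflation E m src := by
    intro k
    induction k with
    | zero => exact fun hk => hstep 0 hk
    | succ k ih =>
      intro hk
      refine mul_flipAt_trans hε ?_ ?_ (ih (by omega)) (hstep (k + 1) hk) <;> simp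
  -- across to the second copy of the first node
  have hlast : inflation E m src * flipAt (⟨N - 2 + 1, by omega⟩, false) (⟨0, by omega⟩, true) =
      ε • inflation E m src := by
    refine hlink _ _ (by simp) fun s _ hs => ?_
    have hne : (m s : ℕ) ≠ 0 := fun h => hm s (by convert hs; exact Fin.ext h)
    have hlt := (m s).2
    simp only [wiring, Fin.lt_def, Bool.false_xor, Bool.true_xor]
    rw [decide_eq_false (by omega), decide_eq_true (by omega)]
    rfl
  have h : inflation E m src * flipAt (⟨0, by omega⟩, false) (⟨0, by omega⟩, true) =
      ε • inflation E m src := by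
    refine mul_flipAt_trans hε ?_ ?_ (hchain (N - 2) (by omega)) hlast <;> simp
  rw [← trace_inflation_mul_flipAt_copies (m := m) hE, h, Matrix.trace_smul, hγ.2, smul_eq_mul,
    mul_one]

end Network

/-! ### Bosonic states with pure marginals -/

section Pure

variable {ι : Type} [Fintype ι] [DecidableEq ι] {d : ℕ}

/-- A symmetric state with a pure marginal is a product state: it has overlap `1` with the tensor
power of its marginal. -/
theorem eq_piTensor_marginal {A : Matrix (ι → Fin d) (ι → Fin d) ℂ} (hA : IsDensity A) (a : ι)
    (hflip : ∀ i, i ≠ a → (A * flipAt a i).trace = 1)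
    (hpure : (marginal A a * marginal A a).trace = 1) :
    A = piTensor fun _ => marginal A a := by
  set M := marginal A a with hM
  have hMd : IsDensity M := hA.marginal a
  have hsub : piTensor (localObs a (1 - M)) = 1 - piTensor (localObs a M) := by
    rw [← piTensor_localObs_one a, piTensor_localObs a (1 - M), piTensor_localObs a 1,
      piTensor_localObs a M]
    simp only [Matrix.sub_apply, sub_smul, Finset.sum_sub_distrib]
  have ha : A * piTensor (localObs a M) = A := by
    have h0 := mul_eq_zero_of_trace_mul_eq_zero hA.1
      (localObs_posSemidef a hMd.one_sub_posSemidef) (by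
        rw [← trace_marginal_mul, ← hM, mul_sub, Matrix.mul_one, Matrix.trace_sub, hMd.2, hpure,
          sub_self])
    rw [hsub, mul_sub, Matrix.mul_one, sub_eq_zero] at h0
    exact h0.symm
  have hi : ∀ i, A * piTensor (localObs i M) = A := by
    intro i
    by_cases hia : i = a
    · rw [hia, ha]
    have hF : A * flipAt a i = A := by
      simpa using mul_flipAt_eq_smul hA (Or.inl rfl) (hflip i hia)
    have hconj : flipAt a i * piTensor (localObs a M) * flipAt a i = piTensor (localObs i M) := by
      rw [flipAt_conj_piTensor]
      congr 1
      ext j : 1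
      by_cases hji : j = i
      · simp [localObs, hji]
      by_cases hja : j = a
      · simp [localObs, hja, hia, Ne.symm hia]
      simp [localObs, hji, hja, Equiv.swap_apply_of_ne_of_ne hja hji]
    rw [← hconj, ← Matrix.mul_assoc, ← Matrix.mul_assoc, hF, ha, hF]
  have hT : ∀ T : Finset ι, A * piTensor (fun i => if i ∈ T then M else 1) = A := by
    intro T
    induction T using Finset.induction_on with
    | empty => simp [piTensor_one]
    | insert i T hiT ih =>
      have hmul : piTensor (fun j => if j ∈ insert i T then M else 1) =
          piTensor (fun j => if j ∈ T then M else 1) * piTensor (localObs i M) := by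
        rw [piTensor_mul]
        congr 1
        ext j : 1
        by_cases hji : j = i
        · simp [localObs, hji, hiT]
        · simp [localObs, hji]
      rw [hmul, ← Matrix.mul_assoc, ih, hi]
  have h := hT Finset.univ
  simp only [Finset.mem_univ, if_true] at h
  exact hA.eq_of_trace_mul_eq_one (IsDensity.piTensor fun _ => hMd) (by rw [h, hA.2])

end Pure

/-! ### Permutation symmetry and mixtures -/

section Symmetry

variable {N d : ℕ} {ρ : Matrix (Fin N → Fin d) (Fin N → Fin d) ℂ}

lemma IsPermSymmetric.trace_mul_flipAt (h : IsPermSymmetric ρ) (hρ : IsDensity ρ) {i j : Fin N}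
    (hij : i ≠ j) : (ρ * flipAt i j).trace = 1 := by
  have hP : (symProj i j * flipAt i j : Matrix (Fin N → Fin d) (Fin N → Fin d) ℂ) =
      symProj i j := by
    change ((1 / 2 : ℂ) • (1 + flipAt i j)) * flipAt i j = (1 / 2 : ℂ) • (1 + flipAt i j)
    rw [Matrix.smul_mul, add_mul, flipAt_mul_self, Matrix.one_mul, add_comm]
  rw [← h i j hij, Matrix.mul_assoc, hP, h i j hij, hρ.2]

lemma IsPermAntisymmetric.trace_mul_flipAt (h : IsPermAntisymmetric ρ) (hρ : IsDensity ρ)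
    {i j : Fin N} (hij : i ≠ j) : (ρ * flipAt i j).trace = -1 := by
  have hP : (antisymProj i j * flipAt i j : Matrix (Fin N → Fin d) (Fin N → Fin d) ℂ) =
      -antisymProj i j := by
    change ((1 / 2 : ℂ) • (1 - flipAt i j)) * flipAt i j = -((1 / 2 : ℂ) • (1 - flipAt i j))
    rw [Matrix.smul_mul, sub_mul, flipAt_mul_self, Matrix.one_mul, ← smul_neg, neg_sub]
  rw [← h i j hij, Matrix.mul_assoc, hP, Matrix.mul_neg, h i j hij, Matrix.trace_neg, hρ.2]

/-- An extremal expectation value of a flip is inherited by the components of a mixture. -/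
lemma trace_mul_flipAt_of_sum {ι : Type} [Fintype ι] [DecidableEq ι] {L : ℕ} {p : Fin L → ℝ}
    {σ : Fin L → Matrix (ι → Fin d) (ι → Fin d) ℂ} (hp : ∀ l, 0 ≤ p l) (hp1 : ∑ l, p l = 1)
    (hσ : ∀ l, IsDensity (σ l)) {ε : ℂ} (hε : ε = 1 ∨ ε = -1) {a b : ι}
    (h : ((∑ l, (p l : ℂ) • σ l) * flipAt a b).trace = ε) {l : Fin L} (hl : p l ≠ 0) :
    (σ l * flipAt a b).trace = ε := by
  have hεε : ε * ε = 1 := by rcases hε with rfl | rfl <;> simp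
  have hval : ∀ l, (σ l * (1 - ε • flipAt a b)).trace = 1 - ε * (σ l * flipAt a b).trace :=
    fun l => by
      rw [mul_sub, Matrix.mul_one, Matrix.mul_smul, Matrix.trace_sub, Matrix.trace_smul, (hσ l).2,
        smul_eq_mul]
  have hnn : ∀ l ∈ Finset.univ, 0 ≤ (p l : ℂ) * (σ l * (1 - ε • flipAt a b)).trace := fun l _ =>
    mul_nonneg (by exact_mod_cast hp l)
      (trace_mul_nonneg (hσ l).1 (one_sub_smul_flipAt_posSemidef hε a b))
  have hsum : ∑ l, (p l : ℂ) * (σ l * (1 - ε • flipAt a b)).trace = 0 := by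
    simp only [Finset.sum_mul, Matrix.smul_mul, Matrix.trace_sum, Matrix.trace_smul,
      smul_eq_mul] at h
    have hp1' : ∑ l, (p l : ℂ) = 1 := by exact_mod_cast hp1
    simp only [hval]
    simp only [mul_sub, mul_one, Finset.sum_sub_distrib, hp1', mul_left_comm _ ε,
      ← Finset.mul_sum, h, hεε, sub_self]
  have h0 := (Finset.sum_eq_zero_iff_of_nonneg hnn).mp hsum l (Finset.mem_univ l)
  rw [mul_eq_zero, hval, sub_eq_zero] at h0
  have h1 := h0.resolve_left (by exact_mod_cast hl)
  linear_combination (-ε) * h1 -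
    (σ l * flipAt a b : Matrix (ι → Fin d) (ι → Fin d) ℂ).trace * hεε

end Symmetry

/-! ### Fully separable states from shared randomness -/

/-- Discarding the input and preparing the state `σ`, for a one-dimensional input. -/
lemma isChannel_prepare {α β : Type} [Fintype α] [Fintype β] [Unique α] {σ : Matrix β β ℂ}
    (hσ : IsDensity σ) :
    IsChannel ((LinearMap.toSpanSingleton ℂ (Matrix β β ℂ) σ).comp
      (Matrix.entryLinearMap ℂ ℂ (default : α) (default : α))) := by
  refine ⟨fun k X hX => ?_, fun X => ?_⟩
  · exact ((hX.submatrix fun i => (i, default)).kronecker hσ.1)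
  · have h : X.trace = X default default := by simp [Matrix.trace]
    rw [h, LinearMap.comp_apply, LinearMap.toSpanSingleton_apply, Matrix.trace_smul, hσ.2,
      smul_eq_mul, mul_one, Matrix.entryLinearMap_apply]

/-- A fully separable state needs no source at all: the nodes prepare the product states according
to the shared randomness. -/
theorem FullySeparable.generatedWithSources {N d k : ℕ}
    {ρ : Matrix (Fin N → Fin d) (Fin N → Fin d) ℂ} (h : FullySeparable ρ) :
    GeneratedWithSources k ρ := by
  obtain ⟨K, p, σ, hp, hp1, hσ, rfl⟩ := h
  let G : Network N := ⟨0, Fin.elim0⟩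
  have : IsEmpty (Fin G.numSources) := inferInstanceAs (IsEmpty (Fin 0))
  let dim : Fin G.numSources → Fin N → ℕ := fun _ _ => 0
  refine ⟨G, fun s => s.elim0, dim, fun s => s.elim0, K, p, fun l i =>
    (LinearMap.toSpanSingleton ℂ _ (σ l i)).comp (Matrix.entryLinearMap ℂ ℂ default default),
    fun s => s.elim0, hp, hp1, fun l i => isChannel_prepare (hσ l i), ?_⟩
  refine Finset.sum_congr rfl fun l _ => ?_
  congr 1
  simp [tensorMap, Network.globalState, piTensor, Finset.univ_unique]

end QuantumNetwork

theorem mainTheorem1 (N d : ℕ) (hN : 2 ≤ N)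
    (ρ : Matrix (Fin N → Fin d) (Fin N → Fin d) ℂ) (hρ : QuantumNetwork.IsDensity ρ) :
    (QuantumNetwork.IsPermSymmetric ρ →
      (QuantumNetwork.GeneratedWithSources (N - 1) ρ ↔ QuantumNetwork.FullySeparable ρ)) ∧
    (QuantumNetwork.IsPermAntisymmetric ρ →
      ¬ QuantumNetwork.GeneratedWithSources (N - 1) ρ) := by
  open QuantumNetwork Network in
  refine ⟨fun hs => ⟨?_, FullySeparable.generatedWithSources⟩, ?_⟩
  · rintro ⟨G, hG, dim, src, L, p, E, hsrc, hp, hp1, hE, h⟩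
    have hσ := fun l => tensorMap_globalState_isDensity (hE l) hsrc
    refine ⟨L, p, fun l _ => marginal (tensorMap (E l) (G.globalState dim src)) ⟨0, by omega⟩,
      hp, hp1, fun l _ => (hσ l).marginal _, ?_⟩
    rw [h]
    refine Finset.sum_congr rfl fun l _ => ?_
    by_cases hl : p l = 0
    · simp [hl]
    have hflip : ∀ i j : Fin N, i ≠ j →
        (tensorMap (E l) (G.globalState dim src) * flipAt i j).trace = 1 := fun i j hij =>
      trace_mul_flipAt_of_sum hp hp1 hσ (Or.inl rfl) (h ▸ hs.trace_mul_flipAt hρ hij) hl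
    congr 1
    exact eq_piTensor_marginal (hσ l) _ (fun i hi => hflip _ i hi.symm)
      (trace_marginal_mul_self_eq hN (fun s => by have := hG s; omega) (hE l) hsrc (Or.inl rfl)
        hflip)
  · rintro ha ⟨G, hG, dim, src, L, p, E, hsrc, hp, hp1, hE, h⟩
    have hσ := fun l => tensorMap_globalState_isDensity (hE l) hsrc
    obtain ⟨l, -, hl⟩ := Finset.exists_ne_zero_of_sum_ne_zero (hp1.trans_ne one_ne_zero)
    have hneg := trace_marginal_mul_self_eq hN (fun s => by have := hG s; omega) (hE l) hsrc
      (Or.inr rfl) fun i j hij =>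
        trace_mul_flipAt_of_sum hp hp1 hσ (Or.inr rfl) (h ▸ ha.trace_mul_flipAt hρ hij) hl
    -- the purity of the marginal would be `-1`
    have hpos := trace_mul_nonneg ((hσ l).marginal ⟨0, by omega⟩).1
      ((hσ l).marginal ⟨0, by omega⟩).1
    rw [hneg] at hpos
    have := (Complex.le_def.mp hpos).1
    norm_num at this
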